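/- Let $(X,d)$ be a locally compact, second countable metric space with a finite Borel measure $\mu$, let $\delta>0$, and suppose that $(X,d,\mu)$ is Ahlfors $\delta$-regular: there is $C_0\ge 1$ with $C_0^{-1}r^\delta\le\mu(\overline B(x,r))\le C_0r^\delta$ for all $x\in X$ and $0\le r<\operatorname{diam}X$. Let $L^2(X,\mu)$ be the real $L^2$-space, let $$\operatorname{Dom}\mathcal E=\Big\{f\in L^2(X,\mu):\int_X\int_X\frac{|f(x)-f(y)|^2}{d(x,y)^\delta}\,d\mu(y)\,d\mu(x)<\infty\Big\},\qquad \mathcal E(f,g)=\frac12\int_X\int_X\frac{(f(x)-f(y))(g(x)-g(y))}{d(x,y)^\delta}\,d\mu(y)\,d\mu(x)$$ (integrals over the complement of the diagonal), and let $\Delta$ be the positive self-adjoint operator on $L^2(X,\mu)$ associated to the densely defined closed form $\mathcal E$: $\operatorname{Dom}\Delta=R\,L^2(X,\mu)$ and $\Delta Rw=w-Rw$, where $Rw\in\operatorname{Dom}\mathcal E$ is determined by $\langle Rw,g\rangle_{L^2}+\mathcal E(Rw,g)=\langle w,g\rangle_{L^2}$ for all $g\in\operatorname{Dom}\mathcal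 E$. A bounded uniformly continuous function $f:X\to\mathbb R$ is Dini continuous if $\operatorname{Din}(f)=\int_0^1\frac{\omega_f(t)}{t}\,dt<\infty$, where $\omega_f(t)=\sup\{|f(x)-f(y)|:d(x,y)\le t\operatorname{diam}X\}$; its Dini norm is $\|f\|_{\operatorname{Din}}=\|f\|_\infty+\operatorname{Din}(f)$. Then the following hold. 1. Every Dini continuous $f$ lies in $\operatorname{Dom}\Delta$, and there is a constant $C$, independent of $f$, such that $\|f\|_{L^2}+\|\Delta f\|_{L^2}\le C\|f\|_{\operatorname{Din}}$ for every Dini continuous $f$. If $\mu\ne0$, then two Dini continuous functions that agree $\mu$-almost everywhere are equal. 2. For every Dini continuous $f$ and every $x\in X$ the function $y\mapsto\frac{f(x)-f(y)}{d(x,y)^\delta}$ (given the value $0$ at $y=x$) is $\mu$-integrable, and its integral equals the principal value $\lim_{\varepsilon\downarrow0}\int_{X\setminus B(x,\varepsilon)}\frac{f(x)-f(y)}{d(x,y)^\delta}\,d\mu(y)$, where $B(x,\varepsilon)$ is the open ball. As an element of $L^2(X,\mu)$, $\Delta f$ is the class of the function $$x\mapsto\int_X\frac{f(x)-f(y)}{d(x,y)^\delta}\,d\mu(y).$$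 Moreover $\Delta f\in L^\infty(X,\mu)$. -/

import Mathlib

open MeasureTheory Set Filter Topology
open scoped ENNReal

noncomputable section

namespace LogLaplacian

/-! ### The operator associated to a bilinear form on a real Hilbert space -/

section Form

variable {H : Type*} [NormedAddCommGroup H] [InnerProductSpace ℝ H]

/-- The graph of the operator `A` associated to a bilinear form `Q` with domain `D`.
Writing `⟪u, g⟫_Q = ⟪u, g⟫ + Q u g`, the resolvent `R` of the form sends `w : H` to the `u ∈ D`
such that `⟪u, g⟫_Q = ⟪w, g⟫` for all `g ∈ D`, and `A` is given on the range of `R` by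
`A (R w) = w - R w`. So `(u, v)` lies in the graph iff `u = R (u + v)`. -/
def formGraph (D : Submodule ℝ H) (Q : D →ₗ[ℝ] D →ₗ[ℝ] ℝ) : Submodule ℝ (H × H) where
  carrier := {p | ∃ hp : p.1 ∈ D, ∀ g : D,
    inner ℝ p.1 (g : H) + Q ⟨p.1, hp⟩ g = inner ℝ (p.1 + p.2) (g : H)}
  zero_mem' := by
    refine ⟨D.zero_mem, fun g => ?_⟩
    have h : (⟨(0 : H × H).1, D.zero_mem⟩ : D) = 0 := rfl
    rw [h]
    simp
  add_mem' := by
    rintro ⟨u, v⟩ ⟨u', v'⟩ ⟨hu, h⟩ ⟨hu', h'⟩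
    refine ⟨D.add_mem hu hu', fun g => ?_⟩
    have e : (⟨((u, v) + (u', v')).1, D.add_mem hu hu'⟩ : D) = ⟨u, hu⟩ + ⟨u', hu'⟩ := rfl
    rw [e]
    have h1 := h g
    have h2 := h' g
    simp only [map_add, LinearMap.add_apply, Prod.mk_add_mk, inner_add_left] at h1 h2 ⊢
    linarith
  smul_mem' := by
    rintro c ⟨u, v⟩ ⟨hu, h⟩
    refine ⟨D.smul_mem c hu, fun g => ?_⟩
    have e : (⟨(c • (u, v)).1, D.smul_mem c hu⟩ : D) = c • ⟨u, hu⟩ := rfl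
    rw [e]
    have h1 := h g
    simp only [map_smul, LinearMap.smul_apply, Prod.smul_mk, inner_add_left,
      real_inner_smul_left, smul_eq_mul] at h1 ⊢
    linear_combination c * h1

/-- The graph above is single valued as soon as the form is densely defined. -/
theorem formGraph_functional (D : Submodule ℝ H) (Q : D →ₗ[ℝ] D →ₗ[ℝ] ℝ)
    (hD : Dense (D : Set H)) : ∀ p ∈ formGraph D Q, p.1 = 0 → p.2 = 0 := by
  rintro ⟨u, v⟩ ⟨hu, h⟩ h0
  have h0' : u = 0 := h0
  subst h0'
  have e : (⟨((0 : H), v).1, hu⟩ : D) = 0 := rfl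
  rw [e] at h
  refine hD.eq_zero_of_inner_left (𝕜 := ℝ) fun g hg => ?_
  have := h ⟨g, hg⟩
  simpa using this.symm

/-- The unbounded operator on `H` associated to a densely defined closed bilinear form `Q`. -/
def formOperator (D : Submodule ℝ H) (Q : D →ₗ[ℝ] D →ₗ[ℝ] ℝ) : H →ₗ.[ℝ] H :=
  (formGraph D Q).toLinearPMap

end Form

/-! ### Ahlfors regularity -/

/-- Ahlfors `δ`-regularity. The diameter is taken in `[0, ∞]`. -/
def IsAhlforsRegular {X : Type*} [MetricSpace X] [MeasurableSpace X] (μ : Measure X) (δ : ℝ) :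
    Prop :=
  0 < δ ∧ ∃ C : ℝ, 1 ≤ C ∧ ∀ (x : X) (r : ℝ), 0 ≤ r →
    ENNReal.ofReal r < Metric.ediam (univ : Set X) →
      ENNReal.ofReal (C⁻¹ * r ^ δ) ≤ μ (Metric.closedBall x r) ∧
        μ (Metric.closedBall x r) ≤ ENNReal.ofReal (C * r ^ δ)

/-! ### Dini continuous functions -/

section Dini

variable {X : Type*} [MetricSpace X]

/-- The modulus of continuity `ω_f(t) = sup {|f x - f y| : d(x, y) ≤ t diam X}`. -/
def modulus (f : X → ℝ) (t : ℝ) : ℝ :=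
  sSup {s | ∃ x y : X, dist x y ≤ t * Metric.diam (univ : Set X) ∧ s = |f x - f y|}

/-- The Dini constant `∫₀¹ ω_f(t) / t dt`, as an element of `[0, ∞]`. -/
def diniConst (f : X → ℝ) : ℝ≥0∞ :=
  ∫⁻ t in Ioc (0 : ℝ) 1, ENNReal.ofReal (modulus f t / t)

/-- Dini continuity: uniformly continuous, bounded, with finite Dini constant. -/
structure IsDini (f : X → ℝ) : Prop where
  uniformContinuous : UniformContinuous f
  bounded : ∃ M : ℝ, ∀ x, |f x| ≤ M
  diniConst_lt_top : diniConst f < ∞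

/-- The Dini norm `‖f‖_∞ + Din(f)`. -/
def diniNorm (f : X → ℝ) : ℝ :=
  (⨆ x, |f x|) + (diniConst f).toReal

theorem IsDini.memLp [SecondCountableTopology X] [MeasurableSpace X] [BorelSpace X]
    {f : X → ℝ} (hf : IsDini f) (μ : Measure X) [IsFiniteMeasure μ] : MemLp f 2 μ := by
  obtain ⟨M, hM⟩ := hf.bounded
  exact MemLp.of_bound hf.uniformContinuous.continuous.aestronglyMeasurable M
    (Eventually.of_forall hM)

/-- The class in `L²(X, μ)` of a Dini continuous function. -/
def IsDini.toL2 [SecondCountableTopology X] [MeasurableSpace X] [BorelSpace X]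
    {f : X → ℝ} (hf : IsDini f) (μ : Measure X) [IsFiniteMeasure μ] : Lp ℝ 2 μ :=
  (hf.memLp μ).toLp f

end Dini

/-! ### The logarithmic Dirichlet form and Laplacian -/

section Laplacian

variable {X : Type*} [MetricSpace X]

/-- The integrand `(f x - f y) (g x - g y) / d(x, y)^δ` of the form. For `δ > 0` it takes the
value `0` on the diagonal, so its integral over `X × X` is that over the complement of the
diagonal. -/
def energyIntegrand (δ : ℝ) (f g : X → ℝ) (p : X × X) : ℝ :=
  (f p.1 - f p.2) * (g p.1 - g p.2) / dist p.1 p.2 ^ δ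

theorem energyIntegrand_comm (δ : ℝ) (f g : X → ℝ) :
    energyIntegrand δ f g = energyIntegrand δ g f := by
  funext p
  simp only [energyIntegrand, mul_comm]

variable [MeasurableSpace X]

theorem energyIntegrand_add_ae (μ : Measure X) [IsFiniteMeasure μ] (δ : ℝ)
    (f f' : Lp ℝ 2 μ) (g : X → ℝ) :
    energyIntegrand δ (f + f' : Lp ℝ 2 μ) g =ᵐ[μ.prod μ]
      energyIntegrand δ f g + energyIntegrand δ f' g := by
  have h := Lp.coeFn_add f f'
  filter_upwards [Measure.quasiMeasurePreserving_fst.ae h,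
    Measure.quasiMeasurePreserving_snd.ae h] with p h1 h2
  simp only [energyIntegrand, h1, h2, Pi.add_apply]
  ring

theorem energyIntegrand_smul_ae (μ : Measure X) [IsFiniteMeasure μ] (δ c : ℝ)
    (f : Lp ℝ 2 μ) (g : X → ℝ) :
    energyIntegrand δ (c • f : Lp ℝ 2 μ) g =ᵐ[μ.prod μ] c • energyIntegrand δ f g := by
  have h := Lp.coeFn_smul c f
  filter_upwards [Measure.quasiMeasurePreserving_fst.ae h,
    Measure.quasiMeasurePreserving_snd.ae h] with p h1 h2
  simp only [energyIntegrand, h1, h2, Pi.smul_apply, smul_eq_mul]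
  ring

variable [SecondCountableTopology X] [BorelSpace X]

theorem aestronglyMeasurable_energyIntegrand (μ : Measure X) [IsFiniteMeasure μ] (δ : ℝ)
    (f g : Lp ℝ 2 μ) :
    AEStronglyMeasurable (energyIntegrand δ f g) (μ.prod μ) := by
  have hf : Measurable (f : X → ℝ) := (Lp.stronglyMeasurable f).measurable
  have hg : Measurable (g : X → ℝ) := (Lp.stronglyMeasurable g).measurable
  have : Measurable (energyIntegrand δ (f : X → ℝ) (g : X → ℝ)) := by
    unfold energyIntegrand
    exact (((hf.comp measurable_fst).sub (hf.comp measurable_snd)).mul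
      ((hg.comp measurable_fst).sub (hg.comp measurable_snd))).div
      ((measurable_fst.dist measurable_snd).pow_const δ)
  exact this.aestronglyMeasurable

theorem integrable_energyIntegrand (μ : Measure X) [IsFiniteMeasure μ] (δ : ℝ)
    {f g : Lp ℝ 2 μ} (hf : Integrable (energyIntegrand δ f f) (μ.prod μ))
    (hg : Integrable (energyIntegrand δ g g) (μ.prod μ)) :
    Integrable (energyIntegrand δ f g) (μ.prod μ) := by
  refine (hf.add hg).mono' (aestronglyMeasurable_energyIntegrand μ δ f g)
    (Eventually.of_forall fun p => ?_)
  have hd : 0 ≤ dist p.1 p.2 ^ δ := Real.rpow_nonneg dist_nonneg δ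
  simp only [energyIntegrand, Pi.add_apply, Real.norm_eq_abs]
  rw [abs_div, abs_of_nonneg hd, ← add_div]
  refine div_le_div_of_nonneg_right ?_ hd
  rw [abs_le]
  constructor <;>
    nlinarith [sq_nonneg ((f p.1 - f p.2) + (g p.1 - g p.2)),
      sq_nonneg ((f p.1 - f p.2) - (g p.1 - g p.2)), sq_nonneg (f p.1 - f p.2),
      sq_nonneg (g p.1 - g p.2)]

/-- The form domain: all `f ∈ L²(X, μ)` with
`∫∫ |f x - f y|² / d(x, y)^δ dμ(y) dμ(x) < ∞`. -/
def formDomain (μ : Measure X) [IsFiniteMeasure μ] (δ : ℝ) : Submodule ℝ (Lp ℝ 2 μ) where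
  carrier := {f | Integrable (fun p : X × X => |f p.1 - f p.2| ^ 2 / dist p.1 p.2 ^ δ)
    (μ.prod μ)}
  zero_mem' := by
    have h := Lp.coeFn_zero ℝ 2 μ
    refine (integrable_zero (X × X) ℝ (μ.prod μ)).congr ?_
    filter_upwards [Measure.quasiMeasurePreserving_fst.ae h,
      Measure.quasiMeasurePreserving_snd.ae h] with p h1 h2
    rw [h1, h2]
    simp
  add_mem' := by
    intro f g hf hg
    simp only [mem_ofPred_eq, sq_abs] at hf hg ⊢
    simp only [sq] at hf hg ⊢
    have key := ((hf.add (integrable_energyIntegrand μ δ hf hg)).add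
      ((integrable_energyIntegrand μ δ hg hf).add hg))
    refine key.congr ?_
    have h := Lp.coeFn_add f g
    filter_upwards [Measure.quasiMeasurePreserving_fst.ae h,
      Measure.quasiMeasurePreserving_snd.ae h] with p h1 h2
    simp only [energyIntegrand, h1, h2, Pi.add_apply]
    ring
  smul_mem' := by
    intro c f hf
    simp only [mem_ofPred_eq, sq_abs] at hf ⊢
    refine (hf.const_mul (c ^ 2)).congr ?_
    have h := Lp.coeFn_smul c f
    filter_upwards [Measure.quasiMeasurePreserving_fst.ae h,
      Measure.quasiMeasurePreserving_snd.ae h] with p h1 h2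
    simp only [h1, h2, Pi.smul_apply, smul_eq_mul]
    ring

theorem mem_formDomain_iff (μ : Measure X) [IsFiniteMeasure μ] (δ : ℝ) (f : Lp ℝ 2 μ) :
    f ∈ formDomain μ δ ↔ Integrable (energyIntegrand δ f f) (μ.prod μ) := by
  change Integrable (fun p : X × X => |f p.1 - f p.2| ^ 2 / dist p.1 p.2 ^ δ) (μ.prod μ) ↔ _
  simp only [sq_abs]
  simp only [sq]
  rfl

/-- The bilinear form
`ℰ(f, g) = 1/2 ∫∫ (f x - f y) (g x - g y) / d(x, y)^δ dμ(y) dμ(x)` on its domain. -/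
def energyForm (μ : Measure X) [IsFiniteMeasure μ] (δ : ℝ) :
    formDomain μ δ →ₗ[ℝ] formDomain μ δ →ₗ[ℝ] ℝ :=
  have hint : ∀ f g : formDomain μ δ,
      Integrable (energyIntegrand δ (f : Lp ℝ 2 μ) (g : Lp ℝ 2 μ)) (μ.prod μ) := fun f g =>
    integrable_energyIntegrand μ δ ((mem_formDomain_iff μ δ _).1 f.2)
      ((mem_formDomain_iff μ δ _).1 g.2)
  have hadd : ∀ f f' g : formDomain μ δ,
      (1 / 2 : ℝ) * ∫ p, energyIntegrand δ ((f + f' : formDomain μ δ) : Lp ℝ 2 μ)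
          (g : Lp ℝ 2 μ) p ∂(μ.prod μ) =
        (1 / 2 : ℝ) * ∫ p, energyIntegrand δ (f : Lp ℝ 2 μ) (g : Lp ℝ 2 μ) p ∂(μ.prod μ) +
        (1 / 2 : ℝ) * ∫ p, energyIntegrand δ (f' : Lp ℝ 2 μ) (g : Lp ℝ 2 μ) p ∂(μ.prod μ) := by
    intro f f' g
    rw [Submodule.coe_add, integral_congr_ae (energyIntegrand_add_ae μ δ _ _ _),
      integral_add' (hint f g) (hint f' g), mul_add]
  have hsmul : ∀ (c : ℝ) (f g : formDomain μ δ),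
      (1 / 2 : ℝ) * ∫ p, energyIntegrand δ ((c • f : formDomain μ δ) : Lp ℝ 2 μ)
          (g : Lp ℝ 2 μ) p ∂(μ.prod μ) =
        c • ((1 / 2 : ℝ) * ∫ p, energyIntegrand δ (f : Lp ℝ 2 μ) (g : Lp ℝ 2 μ) p
          ∂(μ.prod μ)) := by
    intro c f g
    rw [Submodule.coe_smul, integral_congr_ae (energyIntegrand_smul_ae μ δ c _ _)]
    simp only [Pi.smul_apply, smul_eq_mul, integral_const_mul]
    ring
  LinearMap.mk₂ ℝ
    (fun f g => (1 / 2 : ℝ) *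
      ∫ p, energyIntegrand δ (f : Lp ℝ 2 μ) (g : Lp ℝ 2 μ) p ∂(μ.prod μ))
    hadd hsmul
    (fun f g g' => by
      simpa only [energyIntegrand_comm δ ((f : Lp ℝ 2 μ) : X → ℝ)] using hadd g g' f)
    (fun c f g => by
      simpa only [energyIntegrand_comm δ ((f : Lp ℝ 2 μ) : X → ℝ)] using hsmul c g f)

theorem energyForm_apply (μ : Measure X) [IsFiniteMeasure μ] (δ : ℝ) (f g : formDomain μ δ) :
    energyForm μ δ f g = (1 / 2 : ℝ) *
      ∫ p, energyIntegrand δ (f : Lp ℝ 2 μ) (g : Lp ℝ 2 μ) p ∂(μ.prod μ) := rfl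

/-- The logarithmic Dirichlet Laplacian `Δ` on `L²(X, μ)`. -/
def logLaplacian (μ : Measure X) [IsFiniteMeasure μ] (δ : ℝ) : Lp ℝ 2 μ →ₗ.[ℝ] Lp ℝ 2 μ :=
  formOperator (formDomain μ δ) (energyForm μ δ)

end Laplacian

end LogLaplacian

end

open LogLaplacian

namespace LogLaplacian

/-! ### Moduli of continuity -/

/-! Everything rests on one estimate, uniform in `x`: `∫ |f x - f y| / d(x, y)^δ dμ(y) ≤ K ‖f‖_Din`
(`IsAhlforsRegular.exists_lintegral_le`). Finiteness of `μ` bounds the diameter `D`, so `X` minus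
`x` splits into annuli where `d(x, y)` is about `2⁻ᵏ D`. There the kernel's denominator and the
measure of the annulus cancel up to a constant, leaving `ω_f(2⁻ᵏ)`, and the sum of these is
controlled by the Dini integral and the sup norm.

Hence `Tf(x) = ∫ (f x - f y) / d(x, y)^δ dμ(y)` converges absolutely and is bounded. The kernel is
antisymmetric, so Fubini gives `ℰ(f, g) = ⟨Tf, g⟩` for every `g` in the form domain; that is, `(f,
Tf)` lies in the graph defining `Δ` (`IsDini.mem_formGraph`). The form domain contains the Dini
functions, which are dense in `L²` (`dense_formDomain`), so the graph is single valued and `Δf =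
Tf`. All norm bounds then come from the bound on `Tf`. -/

theorem iSup_abs_nonneg {ι : Type*} (f : ι → ℝ) : 0 ≤ ⨆ x, |f x| :=
  Real.iSup_nonneg fun _ => abs_nonneg _

section Kernel

variable {X : Type*} [MetricSpace X]

theorem modulus_nonneg (f : X → ℝ) (t : ℝ) : 0 ≤ modulus f t := by
  apply Real.sSup_nonneg
  rintro s ⟨x, y, -, rfl⟩
  exact abs_nonneg _

theorem IsDini.abs_le_iSup {f : X → ℝ} (hf : IsDini f) (x : X) : |f x| ≤ ⨆ x, |f x| := by
  obtain ⟨M, hM⟩ := hf.bounded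
  exact le_ciSup (f := fun x => |f x|) ⟨M, by rintro _ ⟨y, rfl⟩; exact hM y⟩ x

theorem IsDini.abs_sub_le_modulus {f : X → ℝ} (hf : IsDini f) {t : ℝ} {x y : X}
    (h : dist x y ≤ t * Metric.diam (univ : Set X)) : |f x - f y| ≤ modulus f t := by
  obtain ⟨M, hM⟩ := hf.bounded
  refine le_csSup ⟨2 * M, ?_⟩ ⟨x, y, h, rfl⟩
  rintro _ ⟨x, y, -, rfl⟩
  have := abs_sub (f x) (f y)
  linarith [hM x, hM y]

theorem IsDini.modulus_mono {f : X → ℝ} (hf : IsDini f) : Monotone (modulus f) := by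
  intro s t hst
  refine Real.sSup_le ?_ (modulus_nonneg f t)
  rintro _ ⟨x, y, h, rfl⟩
  exact hf.abs_sub_le_modulus (h.trans (mul_le_mul_of_nonneg_right hst Metric.diam_nonneg))

theorem diniNorm_nonneg (f : X → ℝ) : 0 ≤ diniNorm f :=
  add_nonneg (iSup_abs_nonneg f) ENNReal.toReal_nonneg

theorem IsDini.modulus_le {f : X → ℝ} (hf : IsDini f) (t : ℝ) :
    modulus f t ≤ 2 * ⨆ x, |f x| := by
  refine Real.sSup_le ?_ (mul_nonneg zero_le_two (iSup_abs_nonneg f))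
  rintro _ ⟨x, y, -, rfl⟩
  have := abs_sub (f x) (f y)
  linarith [hf.abs_le_iSup x, hf.abs_le_iSup y]

/-- Here `ω_f(t) / t` is bounded by the constant `K diam X`. This supplies the test functions for
density. -/
theorem isDini_of_lipschitzWith {f : X → ℝ} {K : NNReal} (hf : LipschitzWith K f)
    (hb : ∃ M : ℝ, ∀ x, |f x| ≤ M) : IsDini f where
  uniformContinuous := hf.uniformContinuous
  bounded := hb
  diniConst_lt_top := by
    have key : ∀ t ∈ Ioc (0 : ℝ) 1, ENNReal.ofReal (modulus f t / t) ≤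
        ENNReal.ofReal (K * Metric.diam (univ : Set X)) := by
      intro t ht
      refine ENNReal.ofReal_le_ofReal ((div_le_iff₀ ht.1).2 ?_)
      refine Real.sSup_le ?_ (by have := ht.1.le; positivity)
      rintro _ ⟨x, y, h, rfl⟩
      calc |f x - f y| = dist (f x) (f y) := (Real.dist_eq _ _).symm
        _ ≤ K * dist x y := hf.dist_le_mul x y
        _ ≤ K * (t * Metric.diam (univ : Set X)) := by gcongr
        _ = _ := by ring
    calc diniConst f ≤ ∫⁻ _ in Ioc (0 : ℝ) 1, ENNReal.ofReal (K * Metric.diam (univ : Set X)) :=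
          setLIntegral_mono' measurableSet_Ioc key
      _ < ∞ := by
          rw [setLIntegral_const]
          exact ENNReal.mul_lt_top ENNReal.ofReal_lt_top (by simp)

/-- On `(2⁻ᵏ⁻¹, 2⁻ᵏ]`, an interval of length `2⁻ᵏ⁻¹`, monotonicity gives `ω_f(t) / t ≥ ω_f(2⁻ᵏ⁻¹) /
2⁻ᵏ`, so its share of the Dini integral is at least `ω_f(2⁻ᵏ⁻¹) / 2`. -/
theorem IsDini.tsum_modulus_succ_le {f : X → ℝ} (hf : IsDini f) :
    ∑' k : ℕ, ENNReal.ofReal (modulus f ((1 / 2) ^ (k + 1))) ≤ 2 * diniConst f := by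
  set S : ℕ → Set ℝ := fun k => Ioc ((1 / 2) ^ (k + 1)) ((1 / 2) ^ k) with hS
  have hdisj : Pairwise (Function.onFun Disjoint S) := by
    have hanti : Antitone fun k : ℕ => (1 / 2 : ℝ) ^ k :=
      pow_right_anti₀ (by norm_num) (by norm_num)
    exact hanti.pairwise_disjoint_on_Ioc_succ
  have hsub : (⋃ k, S k) ⊆ Ioc (0 : ℝ) 1 := by
    refine iUnion_subset fun k t ht => ⟨?_, ?_⟩
    · exact lt_trans (by positivity) ht.1
    · exact ht.2.trans (pow_le_one₀ (by norm_num) (by norm_num))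
  have hk : ∀ k : ℕ, ENNReal.ofReal (modulus f ((1 / 2) ^ (k + 1))) ≤
      2 * ∫⁻ t in S k, ENNReal.ofReal (modulus f t / t) := by
    intro k
    have hp : (0 : ℝ) < (1 / 2) ^ k := by positivity
    have h1 : ∫⁻ _ in S k, ENNReal.ofReal (modulus f ((1 / 2) ^ (k + 1)) / (1 / 2) ^ k) ≤
        ∫⁻ t in S k, ENNReal.ofReal (modulus f t / t) := by
      refine setLIntegral_mono' measurableSet_Ioc fun t ht => ENNReal.ofReal_le_ofReal ?_
      have ht0 : 0 < t := lt_trans (by positivity) ht.1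
      exact div_le_div₀ (modulus_nonneg f t) (hf.modulus_mono ht.1.le) ht0 ht.2
    refine le_trans (le_of_eq ?_) (mul_le_mul_right h1 2)
    rw [setLIntegral_const, Real.volume_Ioc, ← ENNReal.ofReal_mul
      (div_nonneg (modulus_nonneg _ _) hp.le), ← ENNReal.ofReal_ofNat 2,
      ← ENNReal.ofReal_mul (by norm_num)]
    congr 1
    field_simp
    ring
  calc _ ≤ ∑' k : ℕ, 2 * ∫⁻ t in S k, ENNReal.ofReal (modulus f t / t) := ENNReal.tsum_le_tsum hk
    _ = 2 * ∫⁻ t in ⋃ k, S k, ENNReal.ofReal (modulus f t / t) := by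
      rw [ENNReal.tsum_mul_left, lintegral_iUnion (fun k => measurableSet_Ioc) hdisj]
    _ ≤ 2 * diniConst f := mul_le_mul_right (lintegral_mono_set hsub) 2

theorem IsDini.tsum_modulus_le {f : X → ℝ} (hf : IsDini f) :
    ∑' k : ℕ, ENNReal.ofReal (modulus f ((1 / 2) ^ k)) ≤ 2 * ENNReal.ofReal (diniNorm f) := by
  -- The term `k = 0` is `ω_f(1)`, not reached by the dyadic comparison; the sup norm pays for it.
  rw [tsum_eq_zero_add' ENNReal.summable, diniNorm,
    ENNReal.ofReal_add (iSup_abs_nonneg f) ENNReal.toReal_nonneg,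
    ENNReal.ofReal_toReal hf.diniConst_lt_top.ne, mul_add]
  refine add_le_add ?_ hf.tsum_modulus_succ_le
  rw [← ENNReal.ofReal_ofNat 2, ← ENNReal.ofReal_mul (by norm_num)]
  exact ENNReal.ofReal_le_ofReal (hf.modulus_le _)

/-! ### Consequences of Ahlfors regularity for finite measures -/

variable [MeasurableSpace X] {μ : Measure X} {δ : ℝ}

theorem IsAhlforsRegular.isOpenPosMeasure (hreg : IsAhlforsRegular μ δ) (hμ : μ ≠ 0) :
    μ.IsOpenPosMeasure := by
  obtain ⟨hδ, C, hC, h⟩ := hreg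
  refine ⟨fun U hU ⟨x, hx⟩ => ?_⟩
  rcases subsingleton_or_nontrivial X with hX | hX
  -- On a one-point space the diameter is `0` and regularity says nothing; positivity comes from `μ
  -- ≠ 0`.
  · have : U = univ := eq_univ_of_forall fun y => Subsingleton.elim x y ▸ hx
    rw [this]
    exact (Measure.measure_univ_ne_zero).2 hμ
  obtain ⟨ε, hε, hball⟩ := Metric.isOpen_iff.1 hU x hx
  have hpos : 0 < Metric.ediam (univ : Set X) := Metric.ediam_pos_iff.2 nontrivial_univ
  obtain ⟨s, hs0, hs⟩ := ENNReal.lt_iff_exists_nnreal_btwn.1 hpos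
  have hs0' : (0 : ℝ) < s := by exact_mod_cast hs0
  set r := min (ε / 2) s with hr
  have hr0 : 0 < r := lt_min (half_pos hε) hs0'
  have hlt : ENNReal.ofReal r < Metric.ediam (univ : Set X) := by
    refine lt_of_le_of_lt ?_ hs
    rw [← ENNReal.ofReal_coe_nnreal]
    exact ENNReal.ofReal_le_ofReal (min_le_right _ _)
  have h1 := (h x r hr0.le hlt).1
  have h2 : 0 < ENNReal.ofReal (C⁻¹ * r ^ δ) := by
    rw [ENNReal.ofReal_pos]
    have := Real.rpow_pos_of_pos hr0 δ
    have : 0 < C := by linarith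
    positivity
  refine (lt_of_lt_of_le h2 (h1.trans (measure_mono ?_))).ne'
  exact (Metric.closedBall_subset_ball
    (lt_of_le_of_lt (min_le_left _ _) (half_lt_self hε))).trans hball

variable [IsFiniteMeasure μ]

/-- With infinite diameter the lower bound `C⁻¹ r^δ ≤ μ(X)` would hold for all `r`, contradicting
finiteness of `μ`. -/
theorem IsAhlforsRegular.ediam_lt_top (hreg : IsAhlforsRegular μ δ) :
    Metric.ediam (univ : Set X) < ∞ := by
  obtain ⟨hδ, C, hC, h⟩ := hreg
  by_contra htop
  rw [not_lt, top_le_iff] at htop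
  rcases isEmpty_or_nonempty X with hX | ⟨⟨x⟩⟩
  · simp [univ_eq_empty_iff.2 hX] at htop
  have hC0 : 0 < C := by linarith
  have hb : ∀ r : ℝ, 0 ≤ r → C⁻¹ * r ^ δ ≤ (μ univ).toReal := fun r hr =>
    (ENNReal.ofReal_le_iff_le_toReal (measure_ne_top μ _)).1
      ((h x r hr (htop ▸ ENNReal.ofReal_lt_top)).1.trans (measure_mono (subset_univ _)))
  have ht : Tendsto (fun r : ℝ => C⁻¹ * r ^ δ) atTop atTop :=
    (tendsto_rpow_atTop hδ).const_mul_atTop (by positivity)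
  obtain ⟨r, hr, hr0⟩ :=
    ((ht.eventually_gt_atTop (μ univ).toReal).and (eventually_ge_atTop 0)).exists
  exact absurd (hb r hr0) (not_le.2 hr)

theorem IsAhlforsRegular.dist_le_diam (hreg : IsAhlforsRegular μ δ) (x y : X) :
    dist x y ≤ Metric.diam (univ : Set X) :=
  Metric.dist_le_diam_of_mem' hreg.ediam_lt_top.ne (mem_univ x) (mem_univ y)

/-- Regularity only covers `r < diam X`, while the outermost dyadic ball has radius exactly `diam
X`. Enlarging the constant so that it also bounds the total mass includes this endpoint. -/
theorem IsAhlforsRegular.exists_measure_closedBall_le (hreg : IsAhlforsRegular μ δ) :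
    ∃ A : ℝ, 0 ≤ A ∧ ∀ (x : X) (r : ℝ), 0 < r → r ≤ Metric.diam (univ : Set X) →
      μ (Metric.closedBall x r) ≤ ENNReal.ofReal (A * r ^ δ) := by
  have hfin := hreg.ediam_lt_top
  obtain ⟨hδ, C, hC, h⟩ := hreg
  set D := Metric.diam (univ : Set X) with hD
  refine ⟨max C ((μ univ).toReal / D ^ δ), by positivity, fun x r hr hrD => ?_⟩
  rcases hrD.lt_or_eq with hlt | rfl
  · refine ((h x r hr.le ((ENNReal.ofReal_lt_iff_lt_toReal hr.le hfin.ne).2 hlt)).2).trans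
      (ENNReal.ofReal_le_ofReal ?_)
    gcongr
    exact le_max_left _ _
  · refine (measure_mono (subset_univ _)).trans ?_
    refine (ENNReal.le_ofReal_iff_toReal_le (measure_ne_top μ univ) (by positivity)).2 ?_
    have hp : 0 < D ^ δ := Real.rpow_pos_of_pos hr δ
    calc (μ univ).toReal = (μ univ).toReal / D ^ δ * D ^ δ := by field_simp
      _ ≤ max C ((μ univ).toReal / D ^ δ) * D ^ δ :=
        mul_le_mul_of_nonneg_right (le_max_right _ _) hp.le

/-! ### The kernel of the Laplacian -/

/-- On the annulus `S k` the integrand is at most `ω_f(2⁻ᵏ) / (2⁻ᵏ⁻¹ D)^δ` and the measure at most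
`A (2⁻ᵏ D)^δ`. The product is `A 2^δ ω_f(2⁻ᵏ)`; summing over `k` costs the last factor `2` in the
constant. -/
theorem IsAhlforsRegular.exists_lintegral_le [BorelSpace X] (hreg : IsAhlforsRegular μ δ) :
    ∃ K : ℝ, 0 ≤ K ∧ ∀ (f : X → ℝ), IsDini f → ∀ x : X,
      ∫⁻ y, ‖(f x - f y) / dist x y ^ δ‖ₑ ∂μ ≤ ENNReal.ofReal (K * diniNorm f) := by
  obtain ⟨A, hA, hball⟩ := hreg.exists_measure_closedBall_le
  have hdist := hreg.dist_le_diam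
  set D := Metric.diam (univ : Set X) with hD
  refine ⟨A * 2 ^ δ * 2, by positivity, fun f hf x => ?_⟩
  rcases subsingleton_or_nontrivial X with hX | hX
  · have : ∀ y, f x - f y = 0 := fun y => by rw [Subsingleton.elim x y, sub_self]
    simp [this]
  have hD0 : 0 < D := by
    obtain ⟨a, b, hab⟩ := exists_pair_ne X
    exact (dist_pos.2 hab).trans_le (hdist a b)
  set S : ℕ → Set X := fun k => {y | (1 / 2) ^ (k + 1) * D < dist x y ∧ dist x y ≤ (1 / 2) ^ k * D}
  have hSm : ∀ k, MeasurableSet (S k) := fun k =>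
    (measurableSet_lt measurable_const (continuous_const.dist continuous_id).measurable).inter
      (measurableSet_le (continuous_const.dist continuous_id).measurable measurable_const)
  set c : ℕ → ℝ := fun k => modulus f ((1 / 2) ^ k) / ((1 / 2) ^ (k + 1) * D) ^ δ with hc
  have hδ := hreg.1
  have hpt : ∀ y, ‖(f x - f y) / dist x y ^ δ‖ₑ ≤
      ∑' k, (S k).indicator (fun _ => ENNReal.ofReal (c k)) y := by
    intro y
    rcases eq_or_ne x y with rfl | hxy
    · simp
    have hd := dist_pos.2 hxy
    obtain ⟨k, hk1, hk2⟩ := exists_nat_pow_near_of_lt_one (x := dist x y / D) (y := 1 / 2)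
      (by positivity) ((div_le_one hD0).2 (hdist x y)) (by norm_num) (by norm_num)
    rw [lt_div_iff₀ hD0] at hk1
    rw [div_le_iff₀ hD0] at hk2
    have hmem : y ∈ S k := ⟨hk1, hk2⟩
    refine le_trans ?_ (ENNReal.le_tsum k)
    rw [indicator_of_mem hmem, ← ofReal_norm]
    refine ENNReal.ofReal_le_ofReal ?_
    rw [norm_div, Real.norm_eq_abs, Real.norm_of_nonneg (Real.rpow_nonneg hd.le δ)]
    exact div_le_div₀ (modulus_nonneg _ _) (hf.abs_sub_le_modulus hk2) (by positivity)
      (Real.rpow_le_rpow (by positivity) hk1.le hδ.le)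
  have hterm : ∀ k, ENNReal.ofReal (c k) * μ (S k) ≤
      ENNReal.ofReal (A * 2 ^ δ) * ENNReal.ofReal (modulus f ((1 / 2) ^ k)) := by
    intro k
    have hp : (0 : ℝ) < (1 / 2) ^ k := by positivity
    have hle : (1 / 2 : ℝ) ^ k * D ≤ D :=
      mul_le_of_le_one_left hD0.le (pow_le_one₀ (by norm_num) (by norm_num))
    have hsub : S k ⊆ Metric.closedBall x ((1 / 2) ^ k * D) := fun y hy => by
      rw [Metric.mem_closedBall, dist_comm]; exact hy.2
    have hm := (measure_mono hsub).trans (hball x _ (by positivity) hle)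
    refine (mul_le_mul_right hm _).trans (le_of_eq ?_)
    have hc0 : 0 ≤ c k := div_nonneg (modulus_nonneg _ _) (by positivity)
    rw [← ENNReal.ofReal_mul hc0, ← ENNReal.ofReal_mul (by positivity)]
    congr 1
    have e : (1 / 2 : ℝ) ^ k * D = 2 * ((1 / 2) ^ (k + 1) * D) := by ring
    have hq : (0 : ℝ) < (1 / 2) ^ (k + 1) * D := by positivity
    have hq' := Real.rpow_pos_of_pos hq δ
    rw [e, Real.mul_rpow zero_le_two hq.le, hc]
    field_simp
  calc ∫⁻ y, ‖(f x - f y) / dist x y ^ δ‖ₑ ∂μ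
      ≤ ∫⁻ y, ∑' k, (S k).indicator (fun _ => ENNReal.ofReal (c k)) y ∂μ := lintegral_mono hpt
    _ = ∑' k, ENNReal.ofReal (c k) * μ (S k) := by
        rw [lintegral_tsum fun k => (measurable_const.indicator (hSm k)).aemeasurable]
        simp_rw [lintegral_indicator_const (hSm _)]
    _ ≤ ∑' k, ENNReal.ofReal (A * 2 ^ δ) * ENNReal.ofReal (modulus f ((1 / 2) ^ k)) :=
        ENNReal.tsum_le_tsum hterm
    _ ≤ ENNReal.ofReal (A * 2 ^ δ) * (2 * ENNReal.ofReal (diniNorm f)) := by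
        rw [ENNReal.tsum_mul_left]
        exact mul_le_mul_right hf.tsum_modulus_le _
    _ = _ := by
        rw [← ENNReal.ofReal_ofNat 2, ← ENNReal.ofReal_mul (by norm_num),
          ← ENNReal.ofReal_mul (by positivity)]
        congr 1
        ring

end Kernel

/-! ### Operators associated to densely defined forms -/

/-- Density makes `formGraph` single valued, which is what lets `toLinearPMap` keep it as its graph.
-/
theorem mem_formOperator_domain {H : Type*} [NormedAddCommGroup H] [InnerProductSpace ℝ H]
    {D : Submodule ℝ H} {Q : D →ₗ[ℝ] D →ₗ[ℝ] ℝ} (hD : Dense (D : Set H)) {u v : H}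
    (h : (u, v) ∈ formGraph D Q) : u ∈ (formOperator D Q).domain := by
  rw [LinearPMap.mem_domain_iff]
  exact ⟨v, by rwa [formOperator, Submodule.toLinearPMap_graph_eq _ (formGraph_functional D Q hD)]⟩

theorem formOperator_eq {H : Type*} [NormedAddCommGroup H] [InnerProductSpace ℝ H]
    {D : Submodule ℝ H} {Q : D →ₗ[ℝ] D →ₗ[ℝ] ℝ} (hD : Dense (D : Set H)) {u v : H}
    (h : (u, v) ∈ formGraph D Q) (hu : u ∈ (formOperator D Q).domain) :
    formOperator D Q ⟨u, hu⟩ = v := by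
  have hg : (formOperator D Q).graph = formGraph D Q :=
    Submodule.toLinearPMap_graph_eq _ (formGraph_functional D Q hD)
  exact (formOperator D Q).mem_graph_snd_inj ((formOperator D Q).mem_graph ⟨u, hu⟩)
    (hg.symm ▸ h) rfl

/-! ### Test functions, the singular integral and its principal value -/

variable {X : Type*} [MetricSpace X]

theorem isDini_thickenedIndicator {ε : ℝ} (hε : 0 < ε) (F : Set X) :
    IsDini fun x => (thickenedIndicator hε F x : ℝ) := by
  refine isDini_of_lipschitzWith (K := ε.toNNReal⁻¹) ?_ ⟨1, fun x => ?_⟩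
  · exact fun x y => lipschitzWith_thickenedIndicator hε F x y
  · rw [abs_of_nonneg (NNReal.coe_nonneg _)]
    exact_mod_cast thickenedIndicator_le_one hε F x

variable [MeasurableSpace X]

/-- The singular integral `∫ (f x - f y) / d(x, y)^δ dμ(y)`. -/
noncomputable def singularIntegral (μ : Measure X) (δ : ℝ) (f : X → ℝ) (x : X) : ℝ :=
  ∫ y, (f x - f y) / dist x y ^ δ ∂μ

variable {μ : Measure X} {δ B : ℝ} {f : X → ℝ}

theorem abs_singularIntegral_le (hB0 : 0 ≤ B) {x : X}
    (hB : ∫⁻ y, ‖(f x - f y) / dist x y ^ δ‖ₑ ∂μ ≤ ENNReal.ofReal B) :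
    ‖singularIntegral μ δ f x‖ ≤ B := by
  have h := (enorm_integral_le_lintegral_enorm (μ := μ)
    (fun y => (f x - f y) / dist x y ^ δ)).trans hB
  rw [← ofReal_norm] at h
  exact (ENNReal.ofReal_le_ofReal_iff hB0).1 h

variable [BorelSpace X]

/-- Thickened indicators of a closed set are Lipschitz, hence Dini, and converge pointwise to its
indicator. By dominated convergence `v` integrates to zero over every closed set. -/
theorem ae_eq_zero_of_integral_mul_isDini {v : X → ℝ} (hv : Integrable v μ)
    (h : ∀ g : X → ℝ, IsDini g → ∫ x, v x * g x ∂μ = 0) : v =ᵐ[μ] 0 := by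
  refine ae_eq_zero_of_forall_setIntegral_isClosed_eq_zero hv fun F hF => ?_
  have hpos : ∀ n : ℕ, (0 : ℝ) < 1 / ((n : ℝ) + 1) := fun n => Nat.one_div_pos_of_nat
  have hlim := tendsto_pi_nhds.1 (thickenedIndicator_tendsto_indicator_closure hpos
    tendsto_one_div_add_atTop_nhds_zero_nat F)
  have hconv : Tendsto (fun n => ∫ x, v x * (thickenedIndicator (hpos n) F x : ℝ) ∂μ) atTop
      (𝓝 (∫ x, F.indicator v x ∂μ)) := by
    refine tendsto_integral_of_dominated_convergence (fun x => ‖v x‖) (fun n => ?_) hv.norm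
      (fun n => ?_) ?_
    · exact hv.aestronglyMeasurable.mul
        (isDini_thickenedIndicator (hpos n) F).uniformContinuous.continuous.aestronglyMeasurable
    · refine Eventually.of_forall fun x => ?_
      rw [norm_mul]
      refine mul_le_of_le_one_right (norm_nonneg _) ?_
      rw [Real.norm_of_nonneg (NNReal.coe_nonneg _)]
      exact_mod_cast thickenedIndicator_le_one (hpos n) F x
    · refine Eventually.of_forall fun x => ?_
      have h1 := (NNReal.tendsto_coe.2 (hlim x)).const_mul (v x)
      rw [hF.closure_eq] at h1
      convert h1 using 2
      by_cases hx : x ∈ F <;> simp [hx]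
  rw [← integral_indicator hF.measurableSet]
  refine tendsto_nhds_unique hconv (tendsto_const_nhds.congr fun n => ?_)
  exact (h _ (isDini_thickenedIndicator (hpos n) F)).symm

/-- Dominated convergence: each `y ≠ x` leaves the ball once `ε < d(y, x)`. The centre is never
recovered, and `h x = 0` makes this harmless even if `x` is an atom. -/
theorem tendsto_setIntegral_compl_ball {x : X} {h : X → ℝ} (hi : Integrable h μ) (h0 : h x = 0) :
    Tendsto (fun ε : ℝ => ∫ y in (Metric.ball x ε)ᶜ, h y ∂μ) (𝓝[>] 0) (𝓝 (∫ y, h y ∂μ)) := by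
  simp_rw [← integral_indicator Metric.isOpen_ball.measurableSet.compl]
  refine tendsto_integral_filter_of_dominated_convergence (fun y => ‖h y‖) ?_ ?_ hi.norm ?_
  · exact Eventually.of_forall fun ε =>
      hi.aestronglyMeasurable.indicator Metric.isOpen_ball.measurableSet.compl
  · exact Eventually.of_forall fun ε => Eventually.of_forall fun y => norm_indicator_le_norm_self _ _
  · refine Eventually.of_forall fun y => ?_
    rcases eq_or_ne y x with rfl | hyx
    · refine tendsto_const_nhds.congr fun ε => ?_
      exact (indicator_apply_eq_self.2 fun _ => h0).symm
    · refine tendsto_const_nhds.congr' ?_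
      filter_upwards [Ioo_mem_nhdsGT (dist_pos.2 hyx)] with ε hε
      rw [indicator_of_mem]
      simpa using hε.2.le

/-! ### The singular integral represents the form on Dini functions -/

variable [SecondCountableTopology X]

theorem IsDini.measurable_quotient {f : X → ℝ} (hf : IsDini f) (δ : ℝ) :
    Measurable fun p : X × X => (f p.1 - f p.2) / dist p.1 p.2 ^ δ := by
  have hm : Measurable f := hf.uniformContinuous.continuous.measurable
  exact ((hm.comp measurable_fst).sub (hm.comp measurable_snd)).div
    ((measurable_fst.dist measurable_snd).pow_const δ)

theorem IsDini.integrable_quotient (hf : IsDini f) {x : X}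
    (hB : ∫⁻ y, ‖(f x - f y) / dist x y ^ δ‖ₑ ∂μ ≤ ENNReal.ofReal B) :
    Integrable (fun y => (f x - f y) / dist x y ^ δ) μ :=
  ⟨((hf.measurable_quotient δ).comp measurable_prodMk_left).aestronglyMeasurable,
    hB.trans_lt ENNReal.ofReal_lt_top⟩

variable [IsFiniteMeasure μ]

theorem IsDini.aestronglyMeasurable_singularIntegral (hf : IsDini f) :
    AEStronglyMeasurable (singularIntegral μ δ f) μ :=
  (hf.measurable_quotient δ).stronglyMeasurable.integral_prod_right'.aestronglyMeasurable

theorem IsDini.memLp_singularIntegral (hf : IsDini f)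
    (hB : ∀ x, ∫⁻ y, ‖(f x - f y) / dist x y ^ δ‖ₑ ∂μ ≤ ENNReal.ofReal B) (hB0 : 0 ≤ B) (p : ℝ≥0∞) :
    MemLp (singularIntegral μ δ f) p μ :=
  MemLp.of_bound hf.aestronglyMeasurable_singularIntegral B
    (Eventually.of_forall fun x => abs_singularIntegral_le hB0 (hB x))

/-- By Tonelli, integrating in `y` first costs at most `B` for each `x` and leaves `B ‖g‖₁`. -/
theorem IsDini.integrable_quotient_mul (hf : IsDini f)
    (hB : ∀ x, ∫⁻ y, ‖(f x - f y) / dist x y ^ δ‖ₑ ∂μ ≤ ENNReal.ofReal B) {g : X → ℝ} (hgm : Measurable g) (hg : Integrable g μ) :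
    Integrable (fun p : X × X => (f p.1 - f p.2) / dist p.1 p.2 ^ δ * g p.1) (μ.prod μ) := by
  have hm : Measurable fun p : X × X => (f p.1 - f p.2) / dist p.1 p.2 ^ δ * g p.1 :=
    (hf.measurable_quotient δ).mul (hgm.comp measurable_fst)
  refine ⟨hm.aestronglyMeasurable, ?_⟩
  rw [HasFiniteIntegral, lintegral_prod _ hm.enorm.aemeasurable]
  calc ∫⁻ x, ∫⁻ y, ‖(f x - f y) / dist x y ^ δ * g x‖ₑ ∂μ ∂μ
      ≤ ∫⁻ x, ENNReal.ofReal B * ‖g x‖ₑ ∂μ := by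
        refine lintegral_mono fun x => ?_
        simp_rw [enorm_mul]
        rw [lintegral_mul_const' _ _ enorm_ne_top]
        exact mul_le_mul_left (hB x) _
    _ = ENNReal.ofReal B * ∫⁻ x, ‖g x‖ₑ ∂μ := lintegral_const_mul' _ _ ENNReal.ofReal_ne_top
    _ < ∞ := ENNReal.mul_lt_top ENNReal.ofReal_lt_top hg.2

/-- Antisymmetry of the quotient in `(x, y)` splits the integrand as `u(x, y) + u(y, x)`. Both
halves are integrable with the same integral, which absorbs the factor `1/2`; Fubini then yields the
pairing with the singular integral. -/
theorem IsDini.integral_energyIntegrand (hf : IsDini f)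
    (hB : ∀ x, ∫⁻ y, ‖(f x - f y) / dist x y ^ δ‖ₑ ∂μ ≤ ENNReal.ofReal B) {g : X → ℝ} (hgm : Measurable g) (hg : Integrable g μ) :
    Integrable (energyIntegrand δ f g) (μ.prod μ) ∧
      (1 / 2 : ℝ) * ∫ p, energyIntegrand δ f g p ∂(μ.prod μ) =
        ∫ x, singularIntegral μ δ f x * g x ∂μ := by
  set u : X × X → ℝ := fun p => (f p.1 - f p.2) / dist p.1 p.2 ^ δ * g p.1 with hu
  have hi : Integrable u (μ.prod μ) := hf.integrable_quotient_mul hB hgm hg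
  have e : energyIntegrand δ f g = fun p => u p + u p.swap := by
    funext p
    simp only [energyIntegrand, hu, Prod.fst_swap, Prod.snd_swap, dist_comm p.2 p.1]
    ring
  rw [e]
  have his : Integrable (fun p : X × X => u p.swap) (μ.prod μ) := hi.swap
  refine ⟨hi.add his, ?_⟩
  have h2 : ∫ p, u p.swap ∂(μ.prod μ) = ∫ p, u p ∂(μ.prod μ) := integral_prod_swap u
  rw [integral_add hi his, h2, integral_prod u hi]
  simp only [hu, integral_mul_const, singularIntegral]
  ring

theorem IsDini.toL2_mem_formDomain (hf : IsDini f)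
    (hB : ∀ x, ∫⁻ y, ‖(f x - f y) / dist x y ^ δ‖ₑ ∂μ ≤ ENNReal.ofReal B) : hf.toL2 μ ∈ formDomain μ δ := by
  rw [mem_formDomain_iff]
  have hm : Measurable f := hf.uniformContinuous.continuous.measurable
  have h := (hf.integral_energyIntegrand hB hm ((hf.memLp μ).integrable one_le_two)).1
  refine h.congr ?_
  have hae := (hf.memLp μ).coeFn_toLp
  filter_upwards [Measure.quasiMeasurePreserving_fst.ae hae,
    Measure.quasiMeasurePreserving_snd.ae hae] with p h1 h2
  simp only [energyIntegrand, IsDini.toL2, h1, h2]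

/-- The `L²` pairing of `f` with `g` cancels from the graph condition, leaving `ℰ(f, g) = ⟨Tf, g⟩`.
Since `μ` is finite, `g ∈ L²` is integrable and the preceding identity applies. -/
theorem IsDini.mem_formGraph (hf : IsDini f)
    (hB : ∀ x, ∫⁻ y, ‖(f x - f y) / dist x y ^ δ‖ₑ ∂μ ≤ ENNReal.ofReal B) (hB0 : 0 ≤ B) :
    (hf.toL2 μ, (hf.memLp_singularIntegral hB hB0 2).toLp _) ∈
      formGraph (formDomain μ δ) (energyForm μ δ) := by
  refine ⟨hf.toL2_mem_formDomain hB, fun g => ?_⟩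
  rw [inner_add_left, add_right_inj, energyForm_apply]
  have hgm : Measurable ((g : Lp ℝ 2 μ) : X → ℝ) := (Lp.stronglyMeasurable _).measurable
  have hgi : Integrable ((g : Lp ℝ 2 μ) : X → ℝ) μ := (Lp.memLp _).integrable one_le_two
  have hae := (hf.memLp μ).coeFn_toLp
  have hcongr : energyIntegrand δ (hf.toL2 μ) (g : Lp ℝ 2 μ) =ᵐ[μ.prod μ]
      energyIntegrand δ f (g : Lp ℝ 2 μ) := by
    filter_upwards [Measure.quasiMeasurePreserving_fst.ae hae,
      Measure.quasiMeasurePreserving_snd.ae hae] with p h1 h2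
    simp only [energyIntegrand, IsDini.toL2, h1, h2]
  rw [integral_congr_ae hcongr, (hf.integral_energyIntegrand hB hgm hgi).2, L2.inner_def]
  refine integral_congr_ae ?_
  filter_upwards [(hf.memLp_singularIntegral hB hB0 2).coeFn_toLp] with x hx
  simp only [hx, RCLike.inner_apply, conj_trivial]
  ring

/-- A vector orthogonal to the form domain is orthogonal to every Dini function, hence zero. -/
theorem dense_formDomain (hreg : IsAhlforsRegular μ δ) :
    Dense (formDomain μ δ : Set (Lp ℝ 2 μ)) := by
  obtain ⟨K, -, hK⟩ := hreg.exists_lintegral_le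
  rw [Submodule.dense_iff_topologicalClosure_eq_top, Submodule.topologicalClosure_eq_top_iff,
    Submodule.eq_bot_iff]
  intro v hv
  rw [Submodule.mem_orthogonal] at hv
  rw [Lp.eq_zero_iff_ae_eq_zero]
  refine ae_eq_zero_of_integral_mul_isDini ((Lp.memLp v).integrable one_le_two) fun g hg => ?_
  have := hv _ (hg.toL2_mem_formDomain (hK g hg))
  rw [L2.inner_def] at this
  rw [← this]
  refine integral_congr_ae ?_
  filter_upwards [(hg.memLp μ).coeFn_toLp] with x hx
  simp only [IsDini.toL2, hx, RCLike.inner_apply, conj_trivial]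

end LogLaplacian

/-! ### The main theorem -/

theorem proposition4p11 {X : Type*} [MetricSpace X] [LocallyCompactSpace X]
    [SecondCountableTopology X] [MeasurableSpace X] [BorelSpace X]
    (μ : Measure X) [IsFiniteMeasure μ] (δ : ℝ) (hreg : IsAhlforsRegular μ δ) :
    -- the inclusion of the Dini functions in the domain, continuous for the graph norm
    (∃ C : ℝ, ∀ (f : X → ℝ) (hf : IsDini f),
      ∃ hdom : hf.toL2 μ ∈ (logLaplacian μ δ).domain,
        ‖hf.toL2 μ‖ + ‖logLaplacian μ δ ⟨hf.toL2 μ, hdom⟩‖ ≤ C * diniNorm f) ∧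
    (μ ≠ 0 → ∀ (f g : X → ℝ) (hf : IsDini f) (hg : IsDini g),
      hf.toL2 μ = hg.toL2 μ → f = g) ∧
    -- the integral representation and the essential boundedness
    (∀ (f : X → ℝ) (hf : IsDini f) (hdom : hf.toL2 μ ∈ (logLaplacian μ δ).domain),
      (∀ x : X, Integrable (fun y => (f x - f y) / dist x y ^ δ) μ ∧
        Tendsto (fun ε : ℝ => ∫ y in (Metric.ball x ε)ᶜ, (f x - f y) / dist x y ^ δ ∂μ)
          (𝓝[>] 0) (𝓝 (∫ y, (f x - f y) / dist x y ^ δ ∂μ))) ∧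
      (logLaplacian μ δ ⟨hf.toL2 μ, hdom⟩ : X → ℝ) =ᵐ[μ]
        (fun x => ∫ y, (f x - f y) / dist x y ^ δ ∂μ) ∧
      MemLp (logLaplacian μ δ ⟨hf.toL2 μ, hdom⟩ : X → ℝ) ∞ μ) := by
  have hdense := dense_formDomain hreg
  obtain ⟨K, hK0, hK⟩ := hreg.exists_lintegral_le
  have hB0 : ∀ f : X → ℝ, 0 ≤ K * diniNorm f := fun f => mul_nonneg hK0 (diniNorm_nonneg f)
  have heq : ∀ (f : X → ℝ) (hf : IsDini f) (hdom : hf.toL2 μ ∈ (logLaplacian μ δ).domain),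
      logLaplacian μ δ ⟨hf.toL2 μ, hdom⟩ =
        (hf.memLp_singularIntegral (hK f hf) (hB0 f) 2).toLp _ := fun f hf hdom =>
    formOperator_eq hdense (hf.mem_formGraph (hK f hf) (hB0 f)) hdom
  refine ⟨?_, fun hμ f g hf hg hfg => ?_, fun f hf hdom => ⟨fun x => ?_, ?_, ?_⟩⟩
  -- `M = μ(X)^(1/2)` converts sup bounds into `L²` bounds, for `f` and for its singular integral,
  -- whence `C = M + M K`.
  · set M : ℝ := (measureUnivNNReal μ : ℝ) ^ (2 : ℝ≥0∞).toReal⁻¹ with hM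
    have hM0 : 0 ≤ M := by positivity
    refine ⟨M + M * K, fun f hf => ?_⟩
    have hdom : hf.toL2 μ ∈ (logLaplacian μ δ).domain :=
      mem_formOperator_domain hdense (hf.mem_formGraph (hK f hf) (hB0 f))
    refine ⟨hdom, ?_⟩
    have h1 : ‖hf.toL2 μ‖ ≤ M * diniNorm f := by
      refine Lp.norm_le_of_ae_bound (diniNorm_nonneg f) ?_
      filter_upwards [(hf.memLp μ).coeFn_toLp] with x hx
      rw [IsDini.toL2, hx]
      exact (hf.abs_le_iSup x).trans (le_add_of_nonneg_right ENNReal.toReal_nonneg)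
    have h2 : ‖logLaplacian μ δ ⟨hf.toL2 μ, hdom⟩‖ ≤ M * (K * diniNorm f) := by
      rw [heq f hf hdom]
      refine Lp.norm_le_of_ae_bound (hB0 f) ?_
      filter_upwards [(hf.memLp_singularIntegral (hK f hf) (hB0 f) 2).coeFn_toLp] with x hx
      rw [hx]
      exact abs_singularIntegral_le (hB0 f) (hK f hf x)
    linarith
  -- Nonempty open sets have positive measure, so continuous functions equal almost everywhere are
  -- equal.
  · have := hreg.isOpenPosMeasure hμ
    exact (hf.uniformContinuous.continuous.ae_eq_iff_eq μ hg.uniformContinuous.continuous).1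
      ((MemLp.toLp_eq_toLp_iff _ _).1 hfg)
  · have hi := hf.integrable_quotient (hK f hf x)
    exact ⟨hi, tendsto_setIntegral_compl_ball hi (by simp)⟩
  · rw [heq f hf hdom]
    exact MemLp.coeFn_toLp _
  · rw [heq f hf hdom]
    exact (memLp_congr_ae (MemLp.coeFn_toLp _)).2
      (hf.memLp_singularIntegral (hK f hf) (hB0 f) ∞)
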